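/- Let $\rho>0$ (density) and $\kappa>0$ (gravitational constant), and set $T=\frac{4\pi}{15}\rho$, $R=\frac{8}{15}\pi^2\kappa\rho^2$. Dirichlet's model is the simple mechanical system with configuration space $\mathrm{SL}(3)=\{F\in\mathbb R^{3\times 3}:\det F=1\}$, metric $\langle\!\langle A,B\rangle\!\rangle=T\,\mathrm{tr}(A^TB)$ on $T_F\mathrm{SL}(3)=\{A:\mathrm{tr}(F^{-1}A)=0\}$, and potential $$V(F)=-R\int_0^\infty\frac{ds}{\sqrt{s^3+I_1(F)s^2+I_2(F)s+1}},\qquad I_1=\mathrm{tr}(FF^T),\quad I_2=\tfrac12\big(\mathrm{tr}(FF^T)^2-\mathrm{tr}((FF^T)^2)\big),$$ that is, the Hamiltonian system on $T^*\mathrm{SL}(3)$, with its canonical symplectic form, of $h(p_F)=\frac12\|p_F\|^2+V(F)$, where $\|\cdot\|$ is the dual norm of the metric. The group $G=\mathbb Z_2\ltimes(\mathrm{SO}(3)\times\mathrm{SO}(3))$, where $\mathbb Z_2=\{e,\sigma\}$ and $\sigma$ exchanges the two factors, acts on $\mathrm{SL}(3)$ by $(e;L,Q)\cdot F=LFQ^T$,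 $(\sigma;L,Q)\cdot F=LF^TQ^T$, and on $T^*\mathrm{SL}(3)$ by the cotangent lift, with momentum map $\langle J(p_F),(\xi_L,\xi_R)\rangle=\langle p_F,\hat\xi_LF-F\hat\xi_R\rangle$, $\xi_L,\xi_R\in\mathbb R^3$, where $\hat\xi v=\xi\times v$. A point $p\in T^*\mathrm{SL}(3)$ is a relative equilibrium if its Hamiltonian orbit lies in $G\cdot p$. A relative equilibrium $p$ with momentum $\mu=J(p)$ and coadjoint isotropy group $G_\mu$ is called (nonlinearly) $G_\mu$-stable if for every $G_\mu$-invariant neighbourhood $U\subset T^*\mathrm{SL}(3)$ of the orbit $G_\mu\cdot p$ there is a neighbourhood $O$ of $p$ such that the Hamiltonian evolution of every point of $O$ exists and lies in $U$ for all time. **Theorem.** Let $p=\langle\!\langle\hat\xi_LF-F\hat\xi_R,\cdot\rangle\!\rangle$ be the spherical equilibrium, with configuration $F=\mathbf I$, angular velocity $\xi_L=0$ and vorticity $\xi_R=0$. Then $p$ is a relative equilibrium, the isotropy group of its momentum is $G_\mu=G$, and $p$ is nonlinearly $G$-stable. -/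

import Mathlib

open Matrix Set Filter Topology MeasureTheory

noncomputable section

namespace Dirichlet

/-- `L(3)`, the space of real `3 × 3` matrices. -/
abbrev Mat : Type := Matrix (Fin 3) (Fin 3) ℝ

/-! ### The symmetry group `ℤ₂ ⋉ (SO(3) × SO(3))` -/

abbrev SO3 : Type := Matrix.specialOrthogonalGroup (Fin 3) ℝ

/-- `ℤ₂ = {e, σ}` is written multiplicatively as `ℤˣ = {1, -1}`, with `σ = -1`. -/
abbrev Z2 : Type := ℤˣ

/-- `σ · (g, h) = (h, g)`. -/
def swapAut : Z2 →* MulAut (SO3 × SO3) where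
  toFun γ := if γ = 1 then 1 else MulEquiv.prodComm
  map_one' := by simp
  map_mul' γ δ := by
    rcases Int.units_eq_one_or γ with rfl | rfl <;> rcases Int.units_eq_one_or δ with rfl | rfl <;>
      ext x <;> simp

/-- The symmetry group; an element is `⟨(g, h), γ⟩`, and
`⟨(g, h), γ⟩ * ⟨(g', h'), γ'⟩ = ⟨(g, h) * (γ · (g', h')), γ * γ'⟩`. -/
abbrev SymGroup : Type := (SO3 × SO3) ⋊[swapAut] Z2

/-- The action on matrices: `(e; L, R) · F = L F Rᵀ` and `(σ; L, R) · F = L Fᵀ Rᵀ`. -/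
def actMat (g : SymGroup) (F : Mat) : Mat :=
  g.left.1.1 * (if g.right = 1 then F else Fᵀ) * g.left.2.1ᵀ

/-! ### The Lie algebra `ℝ³ ⊕ ℝ³` and the adjoint representation -/

abbrev LieAlg : Type := (Fin 3 → ℝ) × (Fin 3 → ℝ)

/-- The hat map `ℝ³ → 𝔰𝔬(3)`. -/
def hat : (Fin 3 → ℝ) →ₗ[ℝ] Mat where
  toFun v := !![0, -v 2, v 1; v 2, 0, -v 0; -v 1, v 0, 0]
  map_add' v w := by
    ext i j; fin_cases i <;> fin_cases j <;> simp <;> ring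
  map_smul' c v := by
    ext i j; fin_cases i <;> fin_cases j <;> simp

/-- The infinitesimal generator `ξ_M(F) = ξ̂_L F - F ξ̂_R`. -/
def infGen (ξ : LieAlg) (F : Mat) : Mat := hat ξ.1 * F - F * hat ξ.2

/-- The adjoint representation: `(e; L, R)` sends `(ξ_L, ξ_R)` to `(L ξ_L, R ξ_R)` and
`(σ; L, R)` sends it to `(L ξ_R, R ξ_L)`. -/
def adjoint : Representation ℝ SymGroup LieAlg where
  toFun g :=
    { toFun := fun ξ =>
        (g.left.1.1 *ᵥ (if g.right = 1 then ξ else ξ.swap).1,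
          g.left.2.1 *ᵥ (if g.right = 1 then ξ else ξ.swap).2)
      map_add' := fun ξ η => by split_ifs <;> simp [Matrix.mulVec_add]
      map_smul' := fun c ξ => by split_ifs <;> simp [Matrix.mulVec_smul] }
  map_one' := by ext <;> simp
  map_mul' g h := by
    refine LinearMap.ext fun ξ => ?_
    simp only [SemidirectProduct.mul_left, SemidirectProduct.mul_right]
    obtain ⟨⟨a, b⟩, γ⟩ := g
    obtain ⟨⟨c, d⟩, δ⟩ := h
    rcases Int.units_eq_one_or γ with rfl | rfl <;> rcases Int.units_eq_one_or δ with rfl | rfl <;>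
      simp [swapAut, Matrix.mulVec_mulVec, -SemidirectProduct.mk_eq_inl_mul_inr]

/-- The isotropy subgroup `G_μ` of `μ ∈ 𝔤*` for the coadjoint action. -/
def momentumIsotropy (μ : Module.Dual ℝ LieAlg) : Subgroup SymGroup where
  carrier := {g | adjoint.dual g μ = μ}
  one_mem' := by
    rw [Set.mem_ofPred_eq, map_one, Module.End.one_apply]
  mul_mem' {a b} ha hb := by
    simp only [Set.mem_ofPred_eq] at ha hb ⊢
    rw [map_mul, Module.End.mul_apply, hb, ha]
  inv_mem' {a} ha := by
    simp only [Set.mem_ofPred_eq] at ha ⊢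
    conv_lhs => rw [← ha]
    rw [← Module.End.mul_apply, ← map_mul, inv_mul_cancel, map_one, Module.End.one_apply]

/-! ### The phase space `T*SL(3)` -/

/-- `T*SL(3)`. A covector at `F ∈ SL(3)` is represented by the unique matrix
`P ∈ T_F SL(3) = {A | tr (F⁻¹ A) = 0}` through which it acts on `T_F SL(3)` as
`A ↦ tr (Pᵀ A)`. -/
abbrev Phase : Type := {x : Mat × Mat // x.1.det = 1 ∧ (x.1⁻¹ * x.2).trace = 0}

theorem actMat_one (F : Mat) : actMat 1 F = F := by simp [actMat]

theorem actMat_mul (g h : SymGroup) (F : Mat) :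
    actMat (g * h) F = actMat g (actMat h F) := by
  simp only [actMat, SemidirectProduct.mul_left, SemidirectProduct.mul_right]
  obtain ⟨⟨a, b⟩, γ⟩ := g
  obtain ⟨⟨c, d⟩, δ⟩ := h
  rcases Int.units_eq_one_or γ with rfl | rfl <;> rcases Int.units_eq_one_or δ with rfl | rfl <;>
    simp [swapAut, Matrix.mul_assoc, -SemidirectProduct.mk_eq_inl_mul_inr]

theorem SO3.transpose_mul_self (a : SO3) : a.1ᵀ * a.1 = 1 := by
  have h := (Matrix.mem_specialOrthogonalGroup_iff.1 a.2).1
  rw [Matrix.mem_orthogonalGroup_iff'] at h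
  exact h

theorem SO3.det_eq_one (a : SO3) : a.1.det = 1 :=
  (Matrix.mem_specialOrthogonalGroup_iff.1 a.2).2

theorem actMat_det (g : SymGroup) (F : Mat) : (actMat g F).det = F.det := by
  rw [actMat]
  split_ifs <;> simp [SO3.det_eq_one]

theorem trace_actMat (g : SymGroup) {F : Mat} (hF : F.det = 1) (P : Mat) :
    ((actMat g F)⁻¹ * actMat g P).trace = (F⁻¹ * P).trace := by
  obtain ⟨⟨a, b⟩, γ⟩ := g
  have ha := SO3.transpose_mul_self a
  have hb := SO3.transpose_mul_self b
  have hu : IsUnit F.det := by simp [hF]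
  have key : ∀ X Y : Mat, X.det = 1 →
      ((a.1 * X * b.1ᵀ)⁻¹ * (a.1 * Y * b.1ᵀ)).trace = (X⁻¹ * Y).trace := by
    intro X Y hX
    have hXu : IsUnit X.det := by simp [hX]
    have hinv : (a.1 * X * b.1ᵀ)⁻¹ = b.1 * X⁻¹ * a.1ᵀ := by
      apply Matrix.inv_eq_left_inv
      calc b.1 * X⁻¹ * a.1ᵀ * (a.1 * X * b.1ᵀ)
          = b.1 * (X⁻¹ * (a.1ᵀ * a.1) * X) * b.1ᵀ := by simp only [Matrix.mul_assoc]
        _ = b.1 * b.1ᵀ := by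
          rw [ha, Matrix.mul_one, Matrix.nonsing_inv_mul _ hXu, Matrix.mul_one]
        _ = 1 := mul_eq_one_comm.1 hb
    rw [hinv]
    calc (b.1 * X⁻¹ * a.1ᵀ * (a.1 * Y * b.1ᵀ)).trace
        = (b.1 * (X⁻¹ * (a.1ᵀ * a.1) * Y) * b.1ᵀ).trace := by simp only [Matrix.mul_assoc]
      _ = (X⁻¹ * Y).trace := by
        rw [ha, Matrix.mul_one, Matrix.trace_mul_comm, ← Matrix.mul_assoc, hb, Matrix.one_mul]
  rcases Int.units_eq_one_or γ with rfl | rfl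
  · simpa [actMat] using key F P hF
  · have h := key Fᵀ Pᵀ (by simpa using hF)
    have h2 : ((Fᵀ)⁻¹ * Pᵀ).trace = (F⁻¹ * P).trace := by
      rw [← Matrix.transpose_nonsing_inv, ← Matrix.transpose_mul, Matrix.trace_transpose,
        Matrix.trace_mul_comm]
    simpa [actMat, h2] using h

/-- The action preserves the trace pairing, so that the cotangent lift of `F ↦ g · F` is
`(F, P) ↦ (g · F, g · P)`. -/
theorem actMat_pairing (g : SymGroup) (P A : Mat) :
    ((actMat g P)ᵀ * actMat g A).trace = (Pᵀ * A).trace := by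
  obtain ⟨⟨a, b⟩, γ⟩ := g
  have ha := SO3.transpose_mul_self a
  have hb := SO3.transpose_mul_self b
  have key : ∀ X Y : Mat,
      ((a.1 * X * b.1ᵀ)ᵀ * (a.1 * Y * b.1ᵀ)).trace = (Xᵀ * Y).trace := by
    intro X Y
    calc ((a.1 * X * b.1ᵀ)ᵀ * (a.1 * Y * b.1ᵀ)).trace
        = (b.1 * (Xᵀ * (a.1ᵀ * a.1) * Y) * b.1ᵀ).trace := by
          simp only [Matrix.transpose_mul, Matrix.transpose_transpose, Matrix.mul_assoc]
      _ = (Xᵀ * Y).trace := by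
        rw [ha, Matrix.mul_one, Matrix.trace_mul_comm, ← Matrix.mul_assoc, hb, Matrix.one_mul]
  rcases Int.units_eq_one_or γ with rfl | rfl
  · simpa [actMat] using key P A
  · have h := key Pᵀ Aᵀ
    have h2 : (P * Aᵀ).trace = (Pᵀ * A).trace := by
      rw [← Matrix.trace_transpose, Matrix.transpose_mul, Matrix.transpose_transpose,
        Matrix.trace_mul_comm]
    simpa [actMat, h2] using h

/-- The cotangent-lifted action on `T*SL(3)`. -/
instance : MulAction SymGroup Phase where
  smul g x := ⟨(actMat g x.1.1, actMat g x.1.2),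
    by rw [actMat_det]; exact x.2.1, by rw [trace_actMat g x.2.1]; exact x.2.2⟩
  one_smul x := Subtype.ext (Prod.ext (actMat_one _) (actMat_one _))
  mul_smul g h x := Subtype.ext (Prod.ext (actMat_mul g h _) (actMat_mul g h _))

/-- The momentum map `⟨J(p_F), ξ⟩ = ⟨p_F, ξ_M(F)⟩`. -/
def momentum (x : Phase) : Module.Dual ℝ LieAlg where
  toFun ξ := (x.1.2ᵀ * infGen ξ x.1.1).trace
  map_add' ξ η := by
    simp only [infGen, Prod.fst_add, Prod.snd_add, map_add, Matrix.add_mul, Matrix.mul_add,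
      Matrix.mul_sub, Matrix.trace_add, Matrix.trace_sub]
    ring
  map_smul' c ξ := by
    simp only [infGen, Prod.smul_fst, Prod.smul_snd, map_smul, Matrix.smul_mul, Matrix.mul_smul,
      Matrix.mul_sub, Matrix.trace_smul, Matrix.trace_sub, smul_eq_mul, RingHom.id_apply]
    ring

/-! ### Energy -/

/-- The constant `T` of the metric `⟪A, B⟫ = T tr (Aᵀ B)`. -/
def metricConst (ρ : ℝ) : ℝ := 4 * Real.pi / 15 * ρ

def I₁ (F : Mat) : ℝ := (F * Fᵀ).trace

def I₂ (F : Mat) : ℝ := ((F * Fᵀ).trace ^ 2 - (F * Fᵀ * (F * Fᵀ)).trace) / 2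

/-- The self-gravitating potential, extended to all matrices independently of `det F`;
`κ` is the gravitational constant. -/
def potential (ρ κ : ℝ) (F : Mat) : ℝ :=
  -(8 / 15 * Real.pi ^ 2 * κ * ρ ^ 2) *
    ∫ s in Ioi (0 : ℝ), 1 / √(s ^ 3 + I₁ F * s ^ 2 + I₂ F * s + 1)

/-- Kinetic plus potential energy. The covector `A ↦ tr (Pᵀ A)` on `T_F SL(3)` is `⟪P / T, ·⟫`,
so its squared norm for the dual metric is `tr (Pᵀ P) / T`. -/
def hamiltonian (ρ κ : ℝ) (x : Mat × Mat) : ℝ :=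
  1 / 2 * ((x.2ᵀ * x.2).trace / metricConst ρ) + potential ρ κ x.1

/-! ### Hamiltonian dynamics on `T*SL(3)` -/

/-- The tangent space of `T*SL(3)` at `(F, P)`: the pairs `(A, B)` annihilated by the differentials
of `det F` and of `tr (F⁻¹ P)`. -/
def tangentSpace (x : Phase) : Set (Mat × Mat) :=
  {w | (x.1.1⁻¹ * w.1).trace = 0 ∧
    (x.1.1⁻¹ * w.2).trace - (x.1.1⁻¹ * w.1 * x.1.1⁻¹ * x.1.2).trace = 0}

/-- The canonical symplectic form of `T*SL(3)`, minus the differential of the Liouville form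
`(A, B) ↦ tr (Pᵀ A)`. -/
def symplecticForm (v w : Mat × Mat) : ℝ := (v.1ᵀ * w.2).trace - (v.2ᵀ * w.1).trace

/-- `v` is the value at `x` of the Hamiltonian vector field: `v` is tangent to `T*SL(3)` and
`ω(v, w) = dh(w)` for all tangent `w`. -/
def IsHamiltonianVector (ρ κ : ℝ) (x : Phase) (v : Mat × Mat) : Prop :=
  v ∈ tangentSpace x ∧
    ∀ w ∈ tangentSpace x, symplecticForm v w = fderiv ℝ (hamiltonian ρ κ) x.1 w

/-- `c` is a solution of Hamilton's equations on the time interval `J`. -/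
def IsTrajectoryOn (ρ κ : ℝ) (c : ℝ → Phase) (J : Set ℝ) : Prop :=
  ∀ t ∈ J, ∃ v, IsHamiltonianVector ρ κ (c t) v ∧
    HasDerivWithinAt (fun s => (c s : Mat × Mat)) v J t

/-- The Hamiltonian evolution of `q` exists and lies in `U` for all time (and so does every
solution through `q` that is only given on some interval). -/
def EvolvesIn (ρ κ : ℝ) (q : Phase) (U : Set Phase) : Prop :=
  (∃ c : ℝ → Phase, c 0 = q ∧ IsTrajectoryOn ρ κ c univ) ∧
    ∀ (c : ℝ → Phase) (J : Set ℝ), J.OrdConnected → (0 : ℝ) ∈ J → c 0 = q →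
      IsTrajectoryOn ρ κ c J → ∀ t ∈ J, c t ∈ U

/-- The Hamiltonian orbit of `p` lies inside its group orbit. -/
def IsRelativeEquilibrium (ρ κ : ℝ) (p : Phase) : Prop :=
  EvolvesIn ρ κ p (MulAction.orbit SymGroup p)

/-- `p` is a relative equilibrium, and for every neighbourhood `U` of the orbit `H · p` that is
invariant under `H` there is a neighbourhood of `p` whose evolution lies in `U` for all time. -/
def IsStableModulo (ρ κ : ℝ) (H : Subgroup SymGroup) (p : Phase) : Prop :=
  IsRelativeEquilibrium ρ κ p ∧
    ∀ U : Set Phase, U ∈ 𝓝ˢ (MulAction.orbit H p) → (∀ g ∈ H, ∀ q ∈ U, g • q ∈ U) →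
      ∃ O ∈ 𝓝 p, ∀ q ∈ O, EvolvesIn ρ κ q U

/-- (Nonlinear) `G_μ`-stability, where `μ = J(p)`. -/
def IsMomentumStable (ρ κ : ℝ) (p : Phase) : Prop :=
  IsStableModulo ρ κ (momentumIsotropy (momentum p)) p

/-! ### The spherical equilibrium -/

/-- The state `p = ⟪ξ_M(F), ·⟫` with configuration `F` and velocity-vorticity pair `ξ`. -/
def stateOf (ρ : ℝ) (F : Mat) (hF : F.det = 1) (ξ : LieAlg) : Phase :=
  ⟨(F, metricConst ρ • infGen ξ F), hF, by
    have hu : IsUnit F.det := by simp [hF]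
    have h : ∀ v, (hat v).trace = 0 := fun v => by simp [hat, Matrix.trace_fin_three]
    rw [Matrix.mul_smul, Matrix.trace_smul, infGen, Matrix.mul_sub, Matrix.trace_sub,
      Matrix.trace_mul_comm, Matrix.mul_assoc, Matrix.mul_nonsing_inv _ hu, Matrix.mul_one,
      ← Matrix.mul_assoc, Matrix.nonsing_inv_mul _ hu, Matrix.one_mul, h, h]
    simp⟩

/-- Identity configuration, zero angular velocity and zero vorticity. -/
def sphericalEquilibrium (ρ : ℝ) : Phase := stateOf ρ 1 Matrix.det_one (0, 0)

end Dirichlet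

end

/-! The spherical equilibrium minimizes the energy, and every minimizer lies on its group orbit;
stability is then an energy confinement argument modulo the group. On SL(3), AM–GM for the
eigenvalues of `F Fᵀ` gives `I₁ ≥ 3`; applied to the adjugate it gives `I₂ ≥ 3`; and `I₁ = 3` forces
`F ∈ SO(3)`. The integral in the potential strictly decreases in `I₁` and does not increase in `I₂`,
so the potential is least exactly at rotations, while the kinetic energy vanishes only at `P = 0`
(`mem_orbit_of_hamiltonian_le`). The momentum is zero, so `G_μ = G` and the full group orbit is the
one to be stabilized.

Compactness turns this into an energy well (`exists_energy_well`): on a compact `K` minus an open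
neighbourhood `W ⊆ K` of the orbit, the energy is at least some `m` above its minimum. A trajectory
starting in `W` with energy below `m` cannot cross `K \ W`.

Existence for all time has to be proved too. The Hamiltonian field is extended to an open set of
matrix pairs, cut off and integrated there; the curves stay on T*SL(3) (`exists_complete_cutoff`).
The cut-off field still conserves energy, so its curves from such points remain where the cutoff
equals 1 and are genuine trajectories (`evolvesIn_of_energy_lt`). -/

noncomputable section

/-! ### Complete flows and smooth cutoffs -/

open scoped NNReal in
/-- A bounded globally Lipschitz vector field has complete integral curves. -/
theorem LipschitzWith.exists_forall_hasDerivAt {E : Type*} [NormedAddCommGroup E]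
    [NormedSpace ℝ E] [CompleteSpace E] {v : E → E} {K L : ℝ≥0} (hv : LipschitzWith K v)
    (hL : ∀ x, ‖v x‖ ≤ L) (x₀ : E) :
    ∃ γ : ℝ → E, γ 0 = x₀ ∧ ∀ t, HasDerivAt γ (v (γ t)) t := by
  have hex : ∀ r : ℝ≥0, ∃ α : ℝ → E, α 0 = x₀ ∧
      ∀ t ∈ Ioo (-(r : ℝ)) r, HasDerivAt α (v (α t)) t := by
    intro r
    -- Speed at most `L` confines a solution to the ball of radius `L * r` during time `r`, so
    -- Picard–Lindelöf covers the whole interval.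
    have hpl : IsPicardLindelof (fun _ : ℝ => v) (tmin := -(r : ℝ)) (tmax := r)
        ⟨0, by simp⟩ x₀ (L * r) 0 L K :=
      { lipschitzOnWith := fun t _ => hv.lipschitzOnWith
        continuousOn := fun x _ => continuousOn_const
        norm_le := fun t _ x _ => hL x
        mul_max_le := by simp }
    obtain ⟨α, h0, hα⟩ := hpl.exists_eq_forall_mem_Icc_hasDerivWithinAt₀
    exact ⟨α, h0, fun t ht => (hα t (Ioo_subset_Icc_self ht)).hasDerivAt (Icc_mem_nhds ht.1 ht.2)⟩
  choose α h0 hα using hex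
  have huniq : ∀ r s : ℝ≥0, r ≤ s → EqOn (α r) (α s) (Ioo (-(r : ℝ)) r) := by
    intro r s hrs t ht
    have hr : (0 : ℝ) < r := by linarith [ht.1, ht.2]
    have hrs' : (r : ℝ) ≤ s := by exact_mod_cast hrs
    refine ODE_solution_unique_of_mem_Ioo (v := fun _ => v) (s := fun _ => univ) (K := K)
      (t₀ := 0) (fun _ _ => hv.lipschitzOnWith) ⟨by linarith, hr⟩
      (fun u hu => ⟨hα r u hu, mem_univ _⟩)
      (fun u hu => ⟨hα s u ⟨by linarith [hu.1], by linarith [hu.2]⟩, mem_univ _⟩)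
      (by rw [h0, h0]) ht
  -- Local solutions are glued by uniqueness; the radius `|t| + 1` makes `t` an interior point of
  -- its interval.
  refine ⟨fun t => α (‖t‖₊ + 1) t, h0 _, fun t => ?_⟩
  have ht : t ∈ Ioo (-((‖t‖₊ + 1 : ℝ≥0) : ℝ)) ((‖t‖₊ + 1 : ℝ≥0) : ℝ) := by
    simp only [NNReal.coe_add, coe_nnnorm, Real.norm_eq_abs, NNReal.coe_one]
    exact ⟨by linarith [neg_abs_le t], by linarith [le_abs_self t]⟩
  refine (hα _ t ht).congr_of_eventuallyEq ?_
  filter_upwards [Ioo_mem_nhds ht.1 ht.2] with u hu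
  have hu' : u ∈ Ioo (-((‖u‖₊ + 1 : ℝ≥0) : ℝ)) ((‖u‖₊ + 1 : ℝ≥0) : ℝ) := by
    simp only [NNReal.coe_add, coe_nnnorm, Real.norm_eq_abs, NNReal.coe_one]
    exact ⟨by linarith [neg_abs_le u], by linarith [le_abs_self u]⟩
  rcases le_total (‖u‖₊ + 1) (‖t‖₊ + 1) with h | h
  · exact huniq _ _ h hu'
  · exact (huniq _ _ h hu).symm

open scoped Manifold in
/-- A smooth cutoff function which is `1` on a compact set, with compact support in a given
open neighbourhood. -/
theorem exists_contDiff_one_zero_of_isCompact {E : Type*} [NormedAddCommGroup E]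
    [NormedSpace ℝ E] [FiniteDimensional ℝ E] {K U : Set E} (hK : IsCompact K) (hU : IsOpen U)
    (hKU : K ⊆ U) : ∃ (χ : E → ℝ) (L : Set E), IsCompact L ∧ L ⊆ U ∧ ContDiff ℝ 1 χ ∧
      (∀ x ∈ K, χ x = 1) ∧ ∀ x ∉ L, χ x = 0 := by
  have : ProperSpace E := FiniteDimensional.proper ℝ E
  obtain ⟨L, hL, hKL, hLU⟩ := exists_compact_between hK hU hKU
  obtain ⟨χ, hχ1, hχ0, -⟩ := exists_contMDiffMap_one_nhds_of_subset_interior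
    (n := 1) 𝓘(ℝ, E) hK.isClosed hKL
  exact ⟨χ, L, hL, hLU, by simpa using χ.contMDiff.contDiff,
    fun x hx => hχ1.self_of_nhdsSet x hx, hχ0⟩

namespace Dirichlet

/-! ### Moments of the cubic: smoothness and monotonicity -/

/-- The moments `∫₀^∞ sᵐ (s³ + a s² + b s + 1)⁻ᵖ ds`, as functions of `(a, b)`. -/
def cubicMoment (m : ℕ) (p : ℝ) (x : ℝ × ℝ) : ℝ :=
  ∫ s in Ioi (0 : ℝ), s ^ m * (s ^ 3 + x.1 * s ^ 2 + x.2 * s + 1) ^ (-p)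

/-- The open quadrant. -/
def quadrant : Set (ℝ × ℝ) := {x | 0 < x.1 ∧ 0 < x.2}

theorem isOpen_quadrant : IsOpen quadrant :=
  (isOpen_lt continuous_const continuous_fst).inter (isOpen_lt continuous_const continuous_snd)

theorem cubicMoment_integrand_nonneg (m : ℕ) (p : ℝ) {x : ℝ × ℝ} (hx : x ∈ quadrant) {s : ℝ}
    (hs : 0 < s) : 0 ≤ s ^ m * (s ^ 3 + x.1 * s ^ 2 + x.2 * s + 1) ^ (-p) := by
  have h1 := hx.1
  have h2 := hx.2
  positivity

/-- The bound does not depend on the point of the quadrant, so it serves as the dominating function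
for differentiation under the integral. It rests on `s³ + 1 - (s + 1)³ / 4 = (3 / 4) (s + 1) (s -
1)² ≥ 0`. -/
theorem cubicMoment_integrand_le (m : ℕ) {p : ℝ} (hp : 0 < p) {x : ℝ × ℝ} (hx : x ∈ quadrant)
    {s : ℝ} (hs : 0 < s) :
    s ^ m * (s ^ 3 + x.1 * s ^ 2 + x.2 * s + 1) ^ (-p) ≤ 4 ^ p * (s + 1) ^ (m - 3 * p) := by
  have h1 := hx.1
  have h2 := hx.2
  have hq : (s + 1) ^ 3 / 4 ≤ s ^ 3 + x.1 * s ^ 2 + x.2 * s + 1 := by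
    have : 0 < x.1 * s ^ 2 + x.2 * s := by positivity
    nlinarith [mul_nonneg (add_pos hs one_pos).le (sq_nonneg (s - 1))]
  have h3 : (s ^ 3 + x.1 * s ^ 2 + x.2 * s + 1) ^ (-p) ≤ ((s + 1) ^ 3 / 4) ^ (-p) :=
    Real.rpow_le_rpow_of_nonpos (by positivity) hq (by linarith)
  have h4 : ((s + 1) ^ 3 / 4) ^ (-p) = 4 ^ p * (s + 1) ^ (-(3 * p)) := by
    rw [Real.div_rpow (by positivity) (by norm_num), Real.rpow_neg (by norm_num : (0 : ℝ) ≤ 4),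
      div_inv_eq_mul, mul_comm, ← Real.rpow_natCast, ← Real.rpow_mul (by positivity)]
    norm_num
  have h5 : (s + 1) ^ (m - 3 * p) = (s + 1) ^ m * (s + 1) ^ (-(3 * p)) := by
    rw [sub_eq_add_neg, Real.rpow_add (by positivity), Real.rpow_natCast]
  rw [h5]
  calc s ^ m * (s ^ 3 + x.1 * s ^ 2 + x.2 * s + 1) ^ (-p)
      ≤ (s + 1) ^ m * ((s + 1) ^ 3 / 4) ^ (-p) := by gcongr; linarith
    _ = 4 ^ p * ((s + 1) ^ m * (s + 1) ^ (-(3 * p))) := by rw [h4]; ring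

theorem integrableOn_cubicMoment_bound {m : ℕ} {p : ℝ} (hmp : (m : ℝ) + 1 < 3 * p) :
    IntegrableOn (fun s : ℝ => 4 ^ p * (s + 1) ^ (m - 3 * p)) (Ioi 0) :=
  (integrableOn_add_rpow_Ioi_of_lt (by linarith) (by norm_num)).const_mul _

theorem measurable_cubicMoment_integrand (m : ℕ) (p : ℝ) (x : ℝ × ℝ) :
    Measurable fun s : ℝ => s ^ m * (s ^ 3 + x.1 * s ^ 2 + x.2 * s + 1) ^ (-p) := by
  fun_prop

theorem integrableOn_cubicMoment {m : ℕ} {p : ℝ} (hmp : (m : ℝ) + 1 < 3 * p) {x : ℝ × ℝ}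
    (hx : x ∈ quadrant) :
    IntegrableOn (fun s : ℝ => s ^ m * (s ^ 3 + x.1 * s ^ 2 + x.2 * s + 1) ^ (-p)) (Ioi 0) := by
  have hp : 0 < p := by have : (0 : ℝ) ≤ m := m.cast_nonneg; linarith
  refine (integrableOn_cubicMoment_bound hmp).mono'
    (measurable_cubicMoment_integrand m p x).aestronglyMeasurable ?_
  filter_upwards [ae_restrict_mem measurableSet_Ioi] with s hs
  rw [Real.norm_of_nonneg (cubicMoment_integrand_nonneg m p hx hs)]
  exact cubicMoment_integrand_le m hp hx hs

/-- Differentiation under the integral sign. The partial derivatives are again moments, and `m + 1 <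
3 p` persists under `(m, p) ↦ (m + 2, p + 1)` and `(m + 1, p + 1)`, so the formula can be iterated.
-/
theorem hasFDerivAt_cubicMoment {m : ℕ} {p : ℝ} (hmp : (m : ℝ) + 1 < 3 * p) {x : ℝ × ℝ}
    (hx : x ∈ quadrant) :
    HasFDerivAt (cubicMoment m p)
      (cubicMoment (m + 2) (p + 1) x • (-p • ContinuousLinearMap.fst ℝ ℝ ℝ) +
        cubicMoment (m + 1) (p + 1) x • (-p • ContinuousLinearMap.snd ℝ ℝ ℝ)) x := by
  have hp : 0 < p := by have : (0 : ℝ) ≤ m := m.cast_nonneg; linarith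
  have h2 : ((m + 2 : ℕ) : ℝ) + 1 < 3 * (p + 1) := by push_cast; linarith
  have h1 : ((m + 1 : ℕ) : ℝ) + 1 < 3 * (p + 1) := by push_cast; linarith
  set A : ℝ × ℝ →L[ℝ] ℝ := -p • ContinuousLinearMap.fst ℝ ℝ ℝ with hA
  set B : ℝ × ℝ →L[ℝ] ℝ := -p • ContinuousLinearMap.snd ℝ ℝ ℝ with hB
  let F' : ℝ × ℝ → ℝ → ℝ × ℝ →L[ℝ] ℝ := fun y s =>
    (s ^ (m + 2) * (s ^ 3 + y.1 * s ^ 2 + y.2 * s + 1) ^ (-(p + 1))) • A +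
      (s ^ (m + 1) * (s ^ 3 + y.1 * s ^ 2 + y.2 * s + 1) ^ (-(p + 1))) • B
  have key : HasFDerivAt (cubicMoment m p) (∫ s in Ioi (0 : ℝ), F' x s) x := by
    refine hasFDerivAt_integral_of_dominated_of_fderiv_le (s := quadrant)
      (bound := fun s => (4 ^ (p + 1) * (s + 1) ^ ((m + 2 : ℕ) - 3 * (p + 1))) * ‖A‖ +
        (4 ^ (p + 1) * (s + 1) ^ ((m + 1 : ℕ) - 3 * (p + 1))) * ‖B‖)
      (isOpen_quadrant.mem_nhds hx)
      (Eventually.of_forall fun y =>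
        (measurable_cubicMoment_integrand m p y).aestronglyMeasurable)
      (integrableOn_cubicMoment hmp hx) ?_ ?_ ?_ ?_
    · exact ((measurable_cubicMoment_integrand _ _ x).aestronglyMeasurable.smul_const _).add
        ((measurable_cubicMoment_integrand _ _ x).aestronglyMeasurable.smul_const _)
    · filter_upwards [ae_restrict_mem measurableSet_Ioi] with s hs y hy
      refine (norm_add_le _ _).trans ?_
      rw [norm_smul _ A, norm_smul _ B, Real.norm_of_nonneg (cubicMoment_integrand_nonneg _ _ hy hs),
        Real.norm_of_nonneg (cubicMoment_integrand_nonneg _ _ hy hs)]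
      exact add_le_add
        (mul_le_mul_of_nonneg_right (cubicMoment_integrand_le _ (by linarith) hy hs)
          (norm_nonneg A))
        (mul_le_mul_of_nonneg_right (cubicMoment_integrand_le _ (by linarith) hy hs)
          (norm_nonneg B))
    · exact ((integrableOn_cubicMoment_bound h2).mul_const _).add
        ((integrableOn_cubicMoment_bound h1).mul_const _)
    · filter_upwards [ae_restrict_mem measurableSet_Ioi] with s hs y hy
      have hs' : 0 < s := hs
      have hy1 := hy.1
      have hy2 := hy.2
      have hq : HasFDerivAt (fun y : ℝ × ℝ => s ^ 3 + y.1 * s ^ 2 + y.2 * s + 1)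
          (s ^ 2 • ContinuousLinearMap.fst ℝ ℝ ℝ + s • ContinuousLinearMap.snd ℝ ℝ ℝ) y :=
        ((((hasFDerivAt_fst (p := y)).mul_const (s ^ 2)).const_add (s ^ 3)).add
          ((hasFDerivAt_snd (p := y)).mul_const s)).add_const 1
      have hne : s ^ 3 + y.1 * s ^ 2 + y.2 * s + 1 ≠ 0 := by positivity
      refine ((hq.rpow_const (p := -p) (Or.inl hne)).const_mul (s ^ m)).congr_fderiv
        (ContinuousLinearMap.ext fun w => ?_)
      simp only [F', hA, hB, _root_.add_apply, _root_.smul_apply,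
        ContinuousLinearMap.coe_fst', ContinuousLinearMap.coe_snd', smul_eq_mul,
        show -p - 1 = -(p + 1) by ring]
      ring
  convert key using 1
  rw [integral_add ((integrableOn_cubicMoment h2 hx).smul_const _)
    ((integrableOn_cubicMoment h1 hx).smul_const _), integral_smul_const, integral_smul_const]
  rfl

theorem contDiffOn_cubicMoment (n : ℕ) {m : ℕ} {p : ℝ} (hmp : (m : ℝ) + 1 < 3 * p) :
    ContDiffOn ℝ n (cubicMoment m p) quadrant := by
  induction n generalizing m p with
  | zero =>
    exact contDiffOn_zero.2 fun x hx =>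
      (hasFDerivAt_cubicMoment hmp hx).continuousAt.continuousWithinAt
  | succ n ih =>
    have h2 : ((m + 2 : ℕ) : ℝ) + 1 < 3 * (p + 1) := by push_cast; linarith
    have h1 : ((m + 1 : ℕ) : ℝ) + 1 < 3 * (p + 1) := by push_cast; linarith
    rw [show ((n + 1 : ℕ) : WithTop ℕ∞) = n + 1 by push_cast; rfl,
      contDiffOn_succ_iff_fderiv_of_isOpen isOpen_quadrant]
    refine ⟨fun x hx => (hasFDerivAt_cubicMoment hmp hx).differentiableAt.differentiableWithinAt,
      by simp, ?_⟩
    refine (((ih h2).smul contDiffOn_const).add ((ih h1).smul contDiffOn_const)).congr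
      fun x hx => (hasFDerivAt_cubicMoment hmp hx).fderiv

theorem cubicMoment_lt {x y : ℝ × ℝ} (hx : x ∈ quadrant) {m : ℕ} {p : ℝ}
    (hmp : (m : ℝ) + 1 < 3 * p) (h1 : x.1 < y.1) (h2 : x.2 ≤ y.2) :
    cubicMoment m p y < cubicMoment m p x := by
  have hp : 0 < p := by have : (0 : ℝ) ≤ m := m.cast_nonneg; linarith
  have hx1 := hx.1
  have hx2 := hx.2
  have hy : y ∈ quadrant := ⟨hx1.trans h1, hx2.trans_le h2⟩
  have hlt : ∀ s ∈ Ioi (0 : ℝ), s ^ m * (s ^ 3 + y.1 * s ^ 2 + y.2 * s + 1) ^ (-p) <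
      s ^ m * (s ^ 3 + x.1 * s ^ 2 + x.2 * s + 1) ^ (-p) := by
    intro s hs
    have hs' : 0 < s := hs
    refine mul_lt_mul_of_pos_left ?_ (by positivity)
    refine Real.rpow_lt_rpow_of_neg (by positivity) ?_ (by linarith)
    have := mul_lt_mul_of_pos_right h1 (pow_pos hs' 2)
    have := mul_le_mul_of_nonneg_right h2 hs'.le
    linarith
  rw [← sub_pos, cubicMoment, cubicMoment, ← integral_sub (integrableOn_cubicMoment hmp hx)
    (integrableOn_cubicMoment hmp hy), setIntegral_pos_iff_support_of_nonneg_ae]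
  · refine lt_of_lt_of_le (b := volume (Ioi (0 : ℝ))) (by simp) (measure_mono fun s hs => ⟨?_, hs⟩)
    exact (sub_pos.2 (hlt s hs)).ne'
  · filter_upwards [ae_restrict_mem measurableSet_Ioi] with s hs
    exact (sub_pos.2 (hlt s hs)).le
  · exact (integrableOn_cubicMoment hmp hx).sub (integrableOn_cubicMoment hmp hy)

/-! ### Calculus of the determinant and the adjugate -/

open scoped Matrix.Norms.Elementwise

theorem contDiff_matrix_apply {n : WithTop ℕ∞} (i j : Fin 3) :
    ContDiff ℝ n fun F : Mat => F i j :=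
  contDiff_pi.1 (contDiff_pi.1 (contDiff_id (𝕜 := ℝ) (E := Mat)) i) j

theorem contDiffOn_matrix {E : Type*} [NormedAddCommGroup E] [NormedSpace ℝ E]
    {n : WithTop ℕ∞} {f : E → Mat} {s : Set E} (h : ∀ i j, ContDiffOn ℝ n (fun x => f x i j) s) :
    ContDiffOn ℝ n f s :=
  contDiffOn_pi.2 fun i => contDiffOn_pi.2 fun j => h i j

theorem hasDerivAt_matrix_apply {F : ℝ → Mat} {F' : Mat} {t : ℝ} (h : HasDerivAt F F' t)
    (i j : Fin 3) : HasDerivAt (fun s => F s i j) (F' i j) t :=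
  hasDerivAt_pi.1 (hasDerivAt_pi.1 h i) j

/-- On SL(3) the inverse is the adjugate, so the constraint on `P` becomes this polynomial, which is
defined for all matrices. -/
theorem trace_adjugate_mul (F P : Mat) : (F.adjugate * P).trace =
    (F 1 1 * F 2 2 - F 1 2 * F 2 1) * P 0 0 + (F 0 2 * F 2 1 - F 0 1 * F 2 2) * P 1 0 +
    (F 0 1 * F 1 2 - F 0 2 * F 1 1) * P 2 0 + (F 1 2 * F 2 0 - F 1 0 * F 2 2) * P 0 1 +
    (F 0 0 * F 2 2 - F 0 2 * F 2 0) * P 1 1 + (F 0 2 * F 1 0 - F 0 0 * F 1 2) * P 2 1 +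
    (F 1 0 * F 2 1 - F 1 1 * F 2 0) * P 0 2 + (F 0 1 * F 2 0 - F 0 0 * F 2 1) * P 1 2 +
    (F 0 0 * F 1 1 - F 0 1 * F 1 0) * P 2 2 := by
  simp only [adjugate_fin_three, trace_fin_three, mul_apply, Fin.sum_univ_three, of_apply,
    cons_val', cons_val_zero, cons_val_one, cons_val, cons_val_fin_one]
  ring

theorem hasDerivAt_det {F : ℝ → Mat} {F' : Mat} {t : ℝ} (h : HasDerivAt F F' t) :
    HasDerivAt (fun s => (F s).det) ((F t).adjugate * F').trace t := by
  have e := hasDerivAt_matrix_apply h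
  simp only [det_fin_three]
  have := ((((((((e 0 0).mul (e 1 1)).mul (e 2 2)).sub (((e 0 0).mul (e 1 2)).mul (e 2 1))).sub
    (((e 0 1).mul (e 1 0)).mul (e 2 2))).add (((e 0 1).mul (e 1 2)).mul (e 2 0))).add
    (((e 0 2).mul (e 1 0)).mul (e 2 1))).sub (((e 0 2).mul (e 1 1)).mul (e 2 0)))
  refine this.congr_deriv ?_
  simp only [trace_adjugate_mul, Pi.mul_apply]
  ring

/-- The factor 2 comes from `det (F + tP) = det F + t tr (adj F · P) + t² tr (F · adj P) + t³ det
P`, whose second derivative at 0 is the variation of `tr (adj F · P)` along `F' = P`. -/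
theorem hasDerivAt_trace_adjugate_mul {F P : ℝ → Mat} {B : Mat} {c t : ℝ}
    (hF : HasDerivAt F (c • P t) t) (hP : HasDerivAt P B t) :
    HasDerivAt (fun s => ((F s).adjugate * P s).trace)
      (((F t).adjugate * B).trace + 2 * c * (F t * (P t).adjugate).trace) t := by
  have e := hasDerivAt_matrix_apply hF
  have k := hasDerivAt_matrix_apply hP
  simp only [trace_adjugate_mul, trace_mul_comm (F t) (P t).adjugate]
  have g : ∀ a b a₂ b₂ a₃ b₃ a₄ b₄ i j : Fin 3, HasDerivAt
      (fun s => (F s a b * F s a₂ b₂ - F s a₃ b₃ * F s a₄ b₄) * P s i j)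
      (c * (P t a b * F t a₂ b₂ + F t a b * P t a₂ b₂ -
        (P t a₃ b₃ * F t a₄ b₄ + F t a₃ b₃ * P t a₄ b₄)) * P t i j +
        (F t a b * F t a₂ b₂ - F t a₃ b₃ * F t a₄ b₄) * B i j) t := by
    intro a b a₂ b₂ a₃ b₃ a₄ b₄ i j
    refine ((((e a b).mul (e a₂ b₂)).sub ((e a₃ b₃).mul (e a₄ b₄))).mul (k i j)).congr_deriv ?_
    simp only [Matrix.smul_apply, smul_eq_mul, Pi.mul_apply, Pi.sub_apply]
    ring
  have := ((((((((g 1 1 2 2 1 2 2 1 0 0).add (g 0 2 2 1 0 1 2 2 1 0)).add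
    (g 0 1 1 2 0 2 1 1 2 0)).add (g 1 2 2 0 1 0 2 2 0 1)).add (g 0 0 2 2 0 2 2 0 1 1)).add
    (g 0 2 1 0 0 0 1 2 2 1)).add (g 1 0 2 1 1 1 2 0 0 2)).add (g 0 1 2 0 0 0 2 1 1 2)).add
    (g 0 0 1 1 0 1 1 0 2 2)
  refine this.congr_deriv ?_
  ring

/-- Newton's identity `tr X² = (tr X)² - 2 tr (adj X)` for `X = adj F · P`, where `adj X = det F ·
adj P · F`. -/
theorem trace_adjugate_mul_adjugate_mul (F P : Mat) :
    (F.adjugate * P * F.adjugate * P).trace =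
      (F.adjugate * P).trace ^ 2 - 2 * F.det * (F * P.adjugate).trace := by
  simp only [adjugate_fin_three, trace_fin_three, mul_apply, Fin.sum_univ_three, det_fin_three,
    of_apply, cons_val', cons_val_zero, cons_val_one, cons_val, cons_val_fin_one]
  ring

/-! ### The invariants `I₁`, `I₂` and their minimum on SL(3) -/

theorem I₁_eq (F : Mat) : I₁ F = F 0 0 ^ 2 + F 0 1 ^ 2 + F 0 2 ^ 2 + F 1 0 ^ 2 + F 1 1 ^ 2 +
    F 1 2 ^ 2 + F 2 0 ^ 2 + F 2 1 ^ 2 + F 2 2 ^ 2 := by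
  simp [I₁, trace_fin_three, mul_apply, Fin.sum_univ_three]
  ring

/-- The second elementary symmetric function of `F Fᵀ` is the trace of its adjugate. Facts about
`I₁` thereby transfer to `I₂`. -/
theorem I₂_eq (F : Mat) : I₂ F = I₁ F.adjugate := by
  simp only [I₁_eq, I₂, adjugate_fin_three, trace_fin_three, mul_apply, Fin.sum_univ_three,
    transpose_apply,
    of_apply, cons_val', cons_val_zero, cons_val_one, cons_val, cons_val_fin_one]
  ring

theorem three_le_of_prod_eq_one {a b c : ℝ} (ha : 0 ≤ a) (hb : 0 ≤ b) (hc : 0 ≤ c)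
    (h : a * b * c = 1) : 3 ≤ a + b + c := by
  by_contra! hlt
  have h1 : 27 * (a * b * c) ≤ (a + b + c) ^ 3 := by
    nlinarith [mul_nonneg ha (sq_nonneg (b - c)), mul_nonneg hb (sq_nonneg (c - a)),
      mul_nonneg hc (sq_nonneg (a - b)), mul_nonneg ha (sq_nonneg (a - b)),
      mul_nonneg ha (sq_nonneg (a - c)), mul_nonneg hb (sq_nonneg (a - b)),
      mul_nonneg hb (sq_nonneg (b - c)), mul_nonneg hc (sq_nonneg (a - c)),
      mul_nonneg hc (sq_nonneg (b - c))]
  have h2 : (a + b + c) ^ 3 < 3 ^ 3 := pow_lt_pow_left₀ hlt (by positivity) (by norm_num)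
  rw [h] at h1
  norm_num at h2
  linarith

theorem three_le_I₁ {F : Mat} (hF : F.det = 1) : 3 ≤ I₁ F := by
  have hpos : (F * Fᵀ).PosSemidef := by
    simpa [conjTranspose_eq_transpose_of_trivial] using posSemidef_self_mul_conjTranspose F
  have hdet := hpos.isHermitian.det_eq_prod_eigenvalues
  have htr := hpos.isHermitian.trace_eq_sum_eigenvalues
  simp [hF, Fin.prod_univ_three] at hdet
  simp [Fin.sum_univ_three] at htr
  rw [I₁, htr]
  exact three_le_of_prod_eq_one (hpos.eigenvalues_nonneg _) (hpos.eigenvalues_nonneg _)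
    (hpos.eigenvalues_nonneg _) hdet.symm

theorem three_le_I₂ {F : Mat} (hF : F.det = 1) : 3 ≤ I₂ F := by
  rw [I₂_eq]
  exact three_le_I₁ (by simp [det_adjugate, hF])

theorem I₁_nonneg (F : Mat) : 0 ≤ I₁ F := by
  rw [I₁_eq]
  positivity

theorem eq_zero_of_I₁_nonpos {F : Mat} (h : I₁ F ≤ 0) : F = 0 := by
  have h0 := le_antisymm h (I₁_nonneg F)
  rw [I₁, ← conjTranspose_eq_transpose_of_trivial] at h0
  exact trace_mul_conjTranspose_self_eq_zero_iff.1 h0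

/-- The squared Frobenius norm of `F Fᵀ - 1` is `I₁² - 2 I₂ - 2 I₁ + 3`, which at `I₁ = 3` equals `6
- 2 I₂ ≤ 0`. -/
theorem mul_transpose_eq_one_of_I₁ {F : Mat} (hF : F.det = 1) (h : I₁ F ≤ 3) : F * Fᵀ = 1 := by
  have h1 : I₁ F = 3 := le_antisymm h (three_le_I₁ hF)
  have h2 := three_le_I₂ hF
  have h3 : I₁ (F * Fᵀ - 1) ≤ 0 := by
    have : I₁ (F * Fᵀ - 1) = (F * Fᵀ * (F * Fᵀ)).trace - 2 * (F * Fᵀ).trace + 3 := by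
      simp only [I₁, transpose_sub, transpose_mul, transpose_transpose, transpose_one, sub_mul,
        mul_sub, trace_sub, Matrix.one_mul, Matrix.mul_one, trace_one, Fintype.card_fin]
      norm_num
      ring
    rw [this]
    rw [I₂] at h2
    rw [I₁] at h1
    rw [h1] at h2 ⊢
    linarith
  exact sub_eq_zero.1 (eq_zero_of_I₁_nonpos h3)

theorem I₂_nonneg (F : Mat) : 0 ≤ I₂ F := by
  rw [I₂_eq]
  exact I₁_nonneg _

/-! ### Smoothness of the potential and differential of the energy -/

theorem potential_eq (ρ κ : ℝ) (F : Mat) : potential ρ κ F =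
    -(8 / 15 * Real.pi ^ 2 * κ * ρ ^ 2) * cubicMoment 0 (1 / 2) (I₁ F, I₂ F) := by
  rw [potential, cubicMoment]
  congr 1
  refine setIntegral_congr_fun measurableSet_Ioi fun s hs => ?_
  have hs' : 0 < s := hs
  have h1 := I₁_nonneg F
  have h2 := I₂_nonneg F
  simp only [pow_zero, one_mul]
  rw [Real.rpow_neg (by positivity), Real.sqrt_eq_rpow, one_div]

theorem contDiff_I₁ {n : WithTop ℕ∞} : ContDiff ℝ n I₁ := by
  have e := @contDiff_matrix_apply n
  rw [show I₁ = _ from funext I₁_eq]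
  exact (((((((((e 0 0).pow 2).add ((e 0 1).pow 2)).add ((e 0 2).pow 2)).add ((e 1 0).pow 2)).add
    ((e 1 1).pow 2)).add ((e 1 2).pow 2)).add ((e 2 0).pow 2)).add ((e 2 1).pow 2)).add
    ((e 2 2).pow 2)

theorem contDiff_adjugate {n : WithTop ℕ∞} : ContDiff ℝ n fun F : Mat => F.adjugate := by
  have e := @contDiff_matrix_apply n
  rw [← contDiffOn_univ]
  refine contDiffOn_matrix fun i j => contDiffOn_univ.2 ?_
  simp only [adjugate_fin_three]
  fin_cases i <;> fin_cases j <;>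
  simp only [Fin.mk_zero, Fin.mk_one, Fin.reduceFinMk, of_apply, cons_val', cons_val_zero,
    cons_val_one, cons_val, cons_val_fin_one] <;>
  fun_prop

theorem contDiff_I₂ {n : WithTop ℕ∞} : ContDiff ℝ n I₂ := by
  rw [show I₂ = _ from funext I₂_eq]
  exact contDiff_I₁.comp contDiff_adjugate

/-- An open set of matrices containing `SL(3)` on which the potential is smooth. -/
def regularSet : Set Mat := {F | 0 < I₁ F ∧ 0 < I₂ F}

theorem isOpen_regularSet : IsOpen regularSet :=
  (isOpen_lt continuous_const (contDiff_I₁ (n := 0)).continuous).inter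
    (isOpen_lt continuous_const (contDiff_I₂ (n := 0)).continuous)

theorem mem_regularSet {F : Mat} (hF : F.det = 1) : F ∈ regularSet :=
  ⟨by linarith [three_le_I₁ hF], by linarith [three_le_I₂ hF]⟩

theorem contDiffOn_potential (ρ κ : ℝ) (n : ℕ) : ContDiffOn ℝ n (potential ρ κ) regularSet := by
  rw [show potential ρ κ = _ from funext (potential_eq ρ κ)]
  refine contDiffOn_const.mul ((contDiffOn_cubicMoment n (by norm_num)).comp
    (contDiff_I₁.prodMk contDiff_I₂).contDiffOn fun F hF => hF)

theorem differentiableAt_potential (ρ κ : ℝ) {F : Mat} (hF : F ∈ regularSet) :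
    DifferentiableAt ℝ (potential ρ κ) F :=
  ((contDiffOn_potential ρ κ 1).contDiffAt (isOpen_regularSet.mem_nhds hF)).differentiableAt
    (by simp)

/-- The gradient of the potential for the trace pairing. -/
def potentialGradient (ρ κ : ℝ) (F : Mat) : Mat :=
  of fun i j => fderiv ℝ (potential ρ κ) F (single i j 1)

theorem trace_potentialGradient_mul (ρ κ : ℝ) (F A : Mat) :
    ((potentialGradient ρ κ F)ᵀ * A).trace = fderiv ℝ (potential ρ κ) F A := by
  conv_rhs => rw [matrix_eq_sum_single A]
  simp only [map_sum]
  rw [trace, Finset.sum_comm]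
  refine Finset.sum_congr rfl fun j _ => ?_
  rw [diag_apply, mul_apply]
  refine Finset.sum_congr rfl fun i _ => ?_
  rw [← mul_one (A i j), ← smul_eq_mul (A i j) 1, ← smul_single, map_smul]
  simp [potentialGradient, mul_comm]

theorem contDiffOn_potentialGradient (ρ κ : ℝ) :
    ContDiffOn ℝ 1 (potentialGradient ρ κ) regularSet :=
  contDiffOn_matrix fun i j =>
    ((contDiffOn_potential ρ κ 2).fderiv_of_isOpen isOpen_regularSet
      (by norm_num)).clm_apply contDiffOn_const

theorem trace_transpose_mul_self (P : Mat) : (Pᵀ * P).trace = I₁ P := by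
  rw [trace_mul_comm, I₁]

/-- `I₁ (F + tA)` is an explicit quadratic in `t`; its linear coefficient is the directional
derivative. -/
theorem fderiv_I₁ (F A : Mat) : fderiv ℝ I₁ F A = 2 * (Fᵀ * A).trace := by
  have h1 := ((contDiff_I₁ (n := 1)).differentiable (by simp) F).hasFDerivAt.hasLineDerivAt A
  have h2 : HasDerivAt (fun t : ℝ => I₁ F + t * (2 * (Fᵀ * A).trace) + t ^ 2 * I₁ A)
      (2 * (Fᵀ * A).trace) 0 := by
    have := (((hasDerivAt_id (0 : ℝ)).mul_const (2 * (Fᵀ * A).trace)).const_add (I₁ F)).add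
      (((hasDerivAt_id (0 : ℝ)).pow 2).mul_const (I₁ A))
    exact this.congr_deriv (by simp)
  refine HasDerivAt.unique (h1 : HasDerivAt (fun t : ℝ => I₁ (F + t • A)) _ 0) ?_
  refine h2.congr_of_eventuallyEq (Eventually.of_forall fun t => ?_)
  simp only [I₁_eq, trace_fin_three, mul_apply, Fin.sum_univ_three, transpose_apply,
    Matrix.add_apply, Matrix.smul_apply, smul_eq_mul]
  ring

theorem hamiltonian_eq (ρ κ : ℝ) : hamiltonian ρ κ =
    fun x => (2 * metricConst ρ)⁻¹ * I₁ x.2 + potential ρ κ x.1 := by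
  funext x
  rw [hamiltonian, trace_transpose_mul_self, mul_inv]
  ring

theorem hasFDerivAt_hamiltonian (ρ κ : ℝ) {x : Mat × Mat} (hx : x.1 ∈ regularSet) :
    HasFDerivAt (hamiltonian ρ κ)
      ((2 * metricConst ρ)⁻¹ • (fderiv ℝ I₁ x.2).comp (ContinuousLinearMap.snd ℝ Mat Mat) +
        (fderiv ℝ (potential ρ κ) x.1).comp (ContinuousLinearMap.fst ℝ Mat Mat)) x := by
  rw [hamiltonian_eq]
  have h1 : HasFDerivAt I₁ (fderiv ℝ I₁ x.2) x.2 :=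
    ((contDiff_I₁ (n := 1)).differentiable (by simp) x.2).hasFDerivAt
  have h2 := (differentiableAt_potential ρ κ hx).hasFDerivAt
  exact ((h1.comp x hasFDerivAt_snd).const_mul _).add (h2.comp x hasFDerivAt_fst)

theorem fderiv_hamiltonian (ρ κ : ℝ) {x : Mat × Mat} (hx : x.1 ∈ regularSet) (w : Mat × Mat) :
    fderiv ℝ (hamiltonian ρ κ) x w = (metricConst ρ)⁻¹ * (x.2ᵀ * w.2).trace +
      ((potentialGradient ρ κ x.1)ᵀ * w.1).trace := by
  rw [(hasFDerivAt_hamiltonian ρ κ hx).fderiv, trace_potentialGradient_mul]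
  simp only [_root_.add_apply, _root_.smul_apply, ContinuousLinearMap.comp_apply,
    ContinuousLinearMap.coe_fst', ContinuousLinearMap.coe_snd', fderiv_I₁, smul_eq_mul, mul_inv]
  ring

theorem continuous_hamiltonian (ρ κ : ℝ) : Continuous fun x : Phase => hamiltonian ρ κ x := by
  refine continuous_iff_continuousAt.2 fun x => ?_
  exact (hasFDerivAt_hamiltonian ρ κ (mem_regularSet x.2.1)).continuousAt.comp
    continuous_subtype_val.continuousAt

/-! ### The Hamiltonian vector field and its cut-off flow -/

/-- The multiplier of the constraint `tr (adj F · P) = 0`. -/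
def multiplier (ρ κ : ℝ) (x : Mat × Mat) : ℝ :=
  (2 * (metricConst ρ)⁻¹ * (x.1 * x.2.adjugate).trace -
    (x.1.adjugate * potentialGradient ρ κ x.1).trace) / I₂ x.1

/-- A vector field on an open set of pairs of matrices which restricts to the Hamiltonian vector
field on `T*SL(3)` and leaves `tr (adj F · P)` constant. -/
def hamiltonianField (ρ κ : ℝ) (x : Mat × Mat) : Mat × Mat :=
  ((metricConst ρ)⁻¹ • x.2,
    -potentialGradient ρ κ x.1 - multiplier ρ κ x • x.1.adjugateᵀ)

/-- This value cancels the `tr (F · adj P)` term in the derivative of `tr (adj F · P)`. It holds off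
T*SL(3) as well, which is what lets the constraint be recovered along ambient integral curves. -/
theorem trace_adjugate_mul_hamiltonianField (ρ κ : ℝ) {x : Mat × Mat} (hx : x.1 ∈ regularSet) :
    (x.1.adjugate * (hamiltonianField ρ κ x).2).trace =
      -(2 * (metricConst ρ)⁻¹ * (x.1 * x.2.adjugate).trace) := by
  have h : (x.1.adjugate * x.1.adjugateᵀ).trace = I₂ x.1 := by rw [I₂_eq, I₁]
  have h0 : I₂ x.1 ≠ 0 := hx.2.ne'
  simp only [hamiltonianField, Matrix.mul_sub, Matrix.mul_neg, Matrix.mul_smul, trace_sub,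
    trace_neg, trace_smul, h, smul_eq_mul]
  rw [multiplier, div_mul_cancel₀ _ h0]
  ring

theorem inv_eq_adjugate {F : Mat} (hF : F.det = 1) : F⁻¹ = F.adjugate := by
  rw [inv_def, hF, Ring.inverse_one, one_smul]

theorem isHamiltonianVector_hamiltonianField (ρ κ : ℝ) (x : Phase) :
    IsHamiltonianVector ρ κ x (hamiltonianField ρ κ x) := by
  have hdet := x.2.1
  have hP := x.2.2
  have hreg := mem_regularSet hdet
  have hB := trace_adjugate_mul_hamiltonianField ρ κ hreg
  rw [inv_eq_adjugate hdet] at hP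
  refine ⟨⟨?_, ?_⟩, fun w hw => ?_⟩
  · rw [inv_eq_adjugate hdet]
    simp [hamiltonianField, hP]
  · rw [inv_eq_adjugate hdet, hB]
    simp only [hamiltonianField, Matrix.mul_smul, Matrix.smul_mul, trace_smul, smul_eq_mul,
      trace_adjugate_mul_adjugate_mul, hP, hdet]
    ring
  -- The multiplier term pairs to zero with `w`, because `tr (adj F · w.1) = 0` for tangent `w`.
  · have hw1 := hw.1
    rw [inv_eq_adjugate hdet] at hw1
    rw [fderiv_hamiltonian ρ κ hreg]
    simp only [symplecticForm, hamiltonianField, transpose_sub, transpose_neg, transpose_smul,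
      transpose_transpose, Matrix.sub_mul, Matrix.neg_mul, Matrix.smul_mul, trace_sub, trace_neg,
      trace_smul, hw1, smul_eq_mul]
    ring

theorem contDiffOn_hamiltonianField (ρ κ : ℝ) :
    ContDiffOn ℝ 1 (hamiltonianField ρ κ) {x | x.1 ∈ regularSet} := by
  have hN : ContDiffOn ℝ 1 (fun x : Mat × Mat => potentialGradient ρ κ x.1)
      {x | x.1 ∈ regularSet} :=
    (contDiffOn_potentialGradient ρ κ).comp contDiff_fst.contDiffOn fun x hx => hx
  have hadj : ContDiff ℝ 1 fun x : Mat × Mat => x.1.adjugate := contDiff_adjugate.comp contDiff_fst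
  have hadj' : ContDiff ℝ 1 fun x : Mat × Mat => x.2.adjugate := contDiff_adjugate.comp contDiff_snd
  have hent : ∀ {f : Mat × Mat → Mat} {s : Set (Mat × Mat)}, ContDiffOn ℝ 1 f s → ∀ i j,
      ContDiffOn ℝ 1 (fun x => f x i j) s := fun hf i j =>
    (contDiff_matrix_apply i j).comp_contDiffOn hf
  have htr : ∀ {f g : Mat × Mat → Mat} {s : Set (Mat × Mat)}, ContDiffOn ℝ 1 f s →
      ContDiffOn ℝ 1 g s → ContDiffOn ℝ 1 (fun x => (f x * g x).trace) s := by
    intro f g s hf hg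
    simp only [trace, diag_apply, mul_apply]
    exact ContDiffOn.sum fun i _ => ContDiffOn.sum fun j _ => (hent hf i j).mul (hent hg j i)
  have hmult : ContDiffOn ℝ 1 (multiplier ρ κ) {x | x.1 ∈ regularSet} :=
    ((contDiffOn_const.mul (htr contDiff_fst.contDiffOn hadj'.contDiffOn)).sub
      (htr hadj.contDiffOn hN)).div (contDiff_I₂.comp contDiff_fst).contDiffOn
      fun x hx => hx.2.ne'
  exact (contDiff_snd.const_smul (metricConst ρ)⁻¹).contDiffOn.prodMk
    (hN.neg.sub (hmult.smul (contDiffOn_matrix fun i j => hent hadj.contDiffOn j i)))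

/-- The Hamiltonian vector field, cut off outside a neighbourhood of a compact set, is complete. -/
theorem exists_complete_cutoff (ρ κ : ℝ) {K : Set Phase} (hK : IsCompact K) :
    ∃ χ : Phase → ℝ, (∀ x ∈ K, χ x = 1) ∧ ∀ q, ∃ c : ℝ → Phase, c 0 = q ∧
      ∀ t, HasDerivAt (fun s => (c s : Mat × Mat)) (χ (c t) • hamiltonianField ρ κ (c t)) t := by
  have hK' : IsCompact (Subtype.val '' K) := hK.image continuous_subtype_val
  have hU : IsOpen {x : Mat × Mat | x.1 ∈ regularSet} := isOpen_regularSet.preimage continuous_fst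
  obtain ⟨χ, L, hL, hLU, hχ, hχ1, hχ0⟩ := exists_contDiff_one_zero_of_isCompact hK' hU (by
    rintro _ ⟨x, -, rfl⟩
    exact mem_regularSet x.2.1)
  set Y : Mat × Mat → Mat × Mat := fun x => χ x • hamiltonianField ρ κ x with hY
  have hY0 : ∀ x ∉ L, Y x = 0 := fun x hx => by simp [hY, hχ0 x hx]
  have hYsupp : HasCompactSupport Y := HasCompactSupport.intro hL hY0
  have hYdiff : ContDiff ℝ 1 Y := by
    refine contDiff_iff_contDiffAt.2 fun x => ?_
    by_cases hx : x ∈ L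
    · exact hχ.contDiffAt.smul
        ((contDiffOn_hamiltonianField ρ κ).contDiffAt (hU.mem_nhds (hLU hx)))
    · refine (contDiffAt_const (c := (0 : Mat × Mat))).congr_of_eventuallyEq ?_
      filter_upwards [hL.isClosed.isOpen_compl.mem_nhds hx] with y hy
      exact hY0 y hy
  obtain ⟨C, hC⟩ := hYdiff.lipschitzWith_of_hasCompactSupport hYsupp one_ne_zero
  obtain ⟨B, hB⟩ := hYsupp.exists_bound_of_continuous hYdiff.continuous
  refine ⟨fun x => χ x, fun x hx => hχ1 x (mem_image_of_mem _ hx), fun q => ?_⟩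
  obtain ⟨γ, hγ0, hγ⟩ := hC.exists_forall_hasDerivAt (L := B.toNNReal)
    (fun x => (hB x).trans (Real.le_coe_toNNReal B)) q
  have hF : ∀ t, HasDerivAt (fun s => (γ s).1)
      ((χ (γ t) * (metricConst ρ)⁻¹) • (γ t).2) t := fun t =>
    HasDerivAt.congr_deriv (f' := χ (γ t) • (metricConst ρ)⁻¹ • (γ t).2) (hγ t).fst
      (smul_smul _ _ _)
  have hP : ∀ t, HasDerivAt (fun s => (γ s).2) (χ (γ t) • (hamiltonianField ρ κ (γ t)).2) t :=
    fun t => (hγ t).snd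
  -- The curve lives in the ambient space so far. The order matters: `tr (adj F · P)` is conserved
  -- outright, and only its vanishing makes `det F` constant.
  have hg : ∀ t, HasDerivAt (fun s => ((γ s).1.adjugate * (γ s).2).trace) 0 t := by
    intro t
    refine (hasDerivAt_trace_adjugate_mul (hF t) (hP t)).congr_deriv ?_
    by_cases ht : γ t ∈ L
    · rw [Matrix.mul_smul, trace_smul, trace_adjugate_mul_hamiltonianField ρ κ (hLU ht),
        smul_eq_mul]
      ring
    · simp [hχ0 _ ht]
  have hg0 : ∀ t, ((γ t).1.adjugate * (γ t).2).trace = 0 := by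
    intro t
    rw [is_const_of_deriv_eq_zero (fun t => (hg t).differentiableAt) (fun t => (hg t).deriv) t 0,
      hγ0, ← inv_eq_adjugate q.2.1]
    exact q.2.2
  have hd : ∀ t, HasDerivAt (fun s => (γ s).1.det) 0 t := fun t =>
    (hasDerivAt_det (hF t)).congr_deriv (by simp [hg0])
  have hd1 : ∀ t, (γ t).1.det = 1 := by
    intro t
    rw [is_const_of_deriv_eq_zero (fun t => (hd t).differentiableAt) (fun t => (hd t).deriv) t 0,
      hγ0]
    exact q.2.1
  exact ⟨fun t => ⟨γ t, hd1 t, by rw [inv_eq_adjugate (hd1 t)]; exact hg0 t⟩, Subtype.ext hγ0, hγ⟩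

/-! ### Energy conservation and confinement -/

/-- Antisymmetry gives `dh(v) = ω(v, v) = 0`. The factor `r` admits rescaled velocities, so the
cut-off flow is covered too. -/
theorem hamiltonian_eq_of_hasDerivWithinAt {ρ κ : ℝ} {c : ℝ → Phase} {J : Set ℝ}
    (hJ : J.OrdConnected) (h : ∀ t ∈ J, ∃ (v : Mat × Mat) (r : ℝ), IsHamiltonianVector ρ κ (c t) v ∧
      HasDerivWithinAt (fun s => (c s : Mat × Mat)) (r • v) J t) {s t : ℝ} (hs : s ∈ J)
    (ht : t ∈ J) : hamiltonian ρ κ (c t) = hamiltonian ρ κ (c s) := by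
  have hd : ∀ u ∈ J, HasDerivWithinAt (fun u => hamiltonian ρ κ (c u)) 0 J u := by
    intro u hu
    obtain ⟨v, r, hv, hc⟩ := h u hu
    have hh := hasFDerivAt_hamiltonian ρ κ (mem_regularSet (c u).2.1)
    have := hh.differentiableAt.hasFDerivAt.comp_hasDerivWithinAt u hc
    have hv0 : fderiv ℝ (hamiltonian ρ κ) (c u) v = 0 := by
      rw [← hv.2 v hv.1, symplecticForm, ← trace_transpose (v.1ᵀ * v.2), transpose_mul,
        transpose_transpose, sub_self]
    exact this.congr_deriv ((ContinuousLinearMap.map_smul _ r v).trans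
      ((congrArg (r • ·) hv0).trans (smul_zero r)))
  have := hJ.convex.norm_image_sub_le_of_norm_hasDerivWithin_le hd (C := 0) (by simp) hs ht
  rw [zero_mul, norm_le_zero_iff] at this
  exact sub_eq_zero.1 this

theorem continuousOn_of_hasDerivWithinAt {c : ℝ → Phase} {J : Set ℝ} {c' : ℝ → Mat × Mat}
    (h : ∀ t ∈ J, HasDerivWithinAt (fun s => (c s : Mat × Mat)) (c' t) J t) : ContinuousOn c J :=
  fun t ht => Topology.IsInducing.subtypeVal.continuousWithinAt_iff.2
    (h t ht).continuousWithinAt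

/-- A continuous curve along which a function stays below its values on the frontier of a set
cannot leave the set. -/
theorem mem_of_continuousOn_of_lt {X : Type*} [TopologicalSpace X] {K W : Set X} (hK : IsClosed K)
    (hW : IsOpen W) (hWK : W ⊆ K) {f : X → ℝ} {m : ℝ} (hm : ∀ x ∈ K \ W, m ≤ f x) {c : ℝ → X}
    {J : Set ℝ} (hJ : J.OrdConnected) (hc : ContinuousOn c J) (hf : ∀ t ∈ J, f (c t) < m)
    {s t : ℝ} (hs : s ∈ J) (ht : t ∈ J) (h : c s ∈ W) : c t ∈ W := by
  have hpre : IsPreconnected (c '' J) := hJ.isPreconnected.image c hc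
  -- The connected image of `J` misses `K \ W`, so it is covered by the disjoint open sets `W` and
  -- `Kᶜ`.
  refine IsPreconnected.subset_left_of_subset_union hW hK.isOpen_compl
    (disjoint_compl_right_iff_subset.2 hWK) ?_ ⟨c s, mem_image_of_mem c hs, h⟩ hpre
    (mem_image_of_mem c ht)
  rintro _ ⟨u, hu, rfl⟩
  by_contra hcon
  rw [mem_union, not_or, notMem_compl_iff] at hcon
  exact (hf u hu).not_ge (hm _ ⟨hcon.2, hcon.1⟩)

/-- If the energy of `q` lies below its values on `K \ W`, then the evolution of `q ∈ W` exists
for all time and remains in `W`. -/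
theorem evolvesIn_of_energy_lt {ρ κ : ℝ} {K W : Set Phase} (hK : IsCompact K) (hW : IsOpen W)
    (hWK : W ⊆ K) {m : ℝ} (hm : ∀ x ∈ K \ W, m ≤ hamiltonian ρ κ x) {q : Phase} (hq : q ∈ W)
    (hqm : hamiltonian ρ κ q < m) : EvolvesIn ρ κ q W := by
  constructor
  · obtain ⟨χ, hχ, hflow⟩ := exists_complete_cutoff ρ κ hK
    obtain ⟨c, hc0, hc⟩ := hflow q
    have hcW : ∀ t, c t ∈ W := by
      intro t
      refine mem_of_continuousOn_of_lt hK.isClosed hW hWK hm ordConnected_univ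
        (continuousOn_of_hasDerivWithinAt fun t _ => (hc t).hasDerivWithinAt) (fun t ht => ?_)
        (mem_univ 0) (mem_univ t) (hc0 ▸ hq)
      rw [hamiltonian_eq_of_hasDerivWithinAt ordConnected_univ (fun t _ =>
        ⟨_, _, isHamiltonianVector_hamiltonianField ρ κ (c t), (hc t).hasDerivWithinAt⟩)
        (mem_univ 0) ht, hc0]
      exact hqm
    refine ⟨c, hc0, fun t _ => ⟨_, isHamiltonianVector_hamiltonianField ρ κ (c t), ?_⟩⟩
    have := (hc t).hasDerivWithinAt (s := univ)
    rwa [hχ _ (hWK (hcW t)), one_smul] at this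
  · intro c J hJ h0 hc0 hc t ht
    have hc' := hc
    choose! v hv hcv using hc'
    refine mem_of_continuousOn_of_lt hK.isClosed hW hWK hm hJ
      (continuousOn_of_hasDerivWithinAt hcv) (fun t ht => ?_) h0 ht (hc0 ▸ hq)
    rw [hamiltonian_eq_of_hasDerivWithinAt hJ (fun t ht => ⟨v t, 1, hv t ht, by
      simpa using hcv t ht⟩) h0 ht, hc0]
    exact hqm

/-! ### The spherical equilibrium as energy minimum -/

theorem metricConst_pos {ρ : ℝ} (hρ : 0 < ρ) : 0 < metricConst ρ := by
  have := Real.pi_pos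
  rw [metricConst]
  positivity

theorem sphericalEquilibrium_val (ρ : ℝ) :
    (sphericalEquilibrium ρ : Mat × Mat) = (1, 0) := by
  simp [sphericalEquilibrium, stateOf, infGen]

theorem momentumIsotropy_sphericalEquilibrium (ρ : ℝ) :
    momentumIsotropy (momentum (sphericalEquilibrium ρ)) = ⊤ := by
  have h : momentum (sphericalEquilibrium ρ) = 0 := by
    ext ξ <;> simp [momentum, sphericalEquilibrium_val]
  rw [h, eq_top_iff]
  intro g _
  exact map_zero (adjoint.dual g)

theorem I₁_one : I₁ 1 = 3 := by simp [I₁]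

theorem I₂_one : I₂ 1 = 3 := by
  rw [I₂_eq, adjugate_one, I₁_one]

/-- The spherical equilibrium minimizes the energy, and any other minimizer is a rotation of it. -/
theorem mem_orbit_of_hamiltonian_le {ρ κ : ℝ} (hρ : 0 < ρ) (hκ : 0 < κ) {x : Phase}
    (hx : hamiltonian ρ κ x ≤ hamiltonian ρ κ (sphericalEquilibrium ρ)) :
    x ∈ MulAction.orbit SymGroup (sphericalEquilibrium ρ) := by
  obtain ⟨⟨F, P⟩, hF, hFP⟩ := x
  have hT := metricConst_pos hρ
  have hR : 0 < 8 / 15 * Real.pi ^ 2 * κ * ρ ^ 2 := by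
    have := Real.pi_pos
    positivity
  have h1 := three_le_I₁ hF
  have h2 := three_le_I₂ hF
  have hI0 : I₁ (0 : Mat) = 0 := by simp [I₁]
  have hmul : 0 < (2 * metricConst ρ)⁻¹ := by positivity
  rw [sphericalEquilibrium_val, hamiltonian_eq] at hx
  simp only [potential_eq, I₁_one, I₂_one, hI0, mul_zero, zero_add] at hx
  have hP0 := I₁_nonneg P
  -- If `I₁ F > 3`, the integral would be strictly below its value at the identity, the potential
  -- strictly above, and the kinetic term cannot compensate.
  have hF3 : I₁ F ≤ 3 := by
    by_contra! hlt
    have := cubicMoment_lt (x := (3, 3)) (y := (I₁ F, I₂ F)) (m := 0) (p := 1 / 2)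
      ⟨by norm_num, by norm_num⟩ (by norm_num) hlt h2
    nlinarith [mul_nonneg hmul.le hP0, mul_pos hR (sub_pos.2 this)]
  have hFF := mul_transpose_eq_one_of_I₁ hF hF3
  have hI₁ : I₁ F = 3 := le_antisymm hF3 h1
  have hI₂ : I₂ F = 3 := by
    simp only [I₂, hFF, Matrix.one_mul, trace_one, Fintype.card_fin]
    norm_num
  rw [hI₁, hI₂, add_le_iff_nonpos_left] at hx
  have hP : P = 0 := eq_zero_of_I₁_nonpos (nonpos_of_mul_nonpos_right hx hmul)
  have hSO : F ∈ specialOrthogonalGroup (Fin 3) ℝ :=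
    mem_specialOrthogonalGroup_iff.2 ⟨(mem_orthogonalGroup_iff (Fin 3) ℝ).2 hFF, hF⟩
  -- A rotation `F` is reached from the identity by `(e; F, 1)`.
  refine ⟨⟨(⟨F, hSO⟩, 1), 1⟩, Subtype.ext ?_⟩
  change (actMat _ (sphericalEquilibrium ρ : Mat × Mat).1,
    actMat _ (sphericalEquilibrium ρ : Mat × Mat).2) = (F, P)
  rw [sphericalEquilibrium_val, hP]
  simp [actMat, -SemidirectProduct.mk_eq_inl_mul_inr]

theorem I₁_actMat (g : SymGroup) (F : Mat) : I₁ (actMat g F) = I₁ F := by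
  rw [← trace_transpose_mul_self, actMat_pairing, trace_transpose_mul_self]

theorem sq_apply_le_I₁ (F : Mat) (i j : Fin 3) : F i j ^ 2 ≤ I₁ F := by
  rw [I₁_eq]
  fin_cases i <;> fin_cases j <;>
  simp only [Fin.mk_zero, Fin.mk_one, Fin.reduceFinMk] <;>
  linarith [sq_nonneg (F 0 0), sq_nonneg (F 0 1), sq_nonneg (F 0 2), sq_nonneg (F 1 0),
    sq_nonneg (F 1 1), sq_nonneg (F 1 2), sq_nonneg (F 2 0), sq_nonneg (F 2 1), sq_nonneg (F 2 2)]

theorem norm_le_of_I₁_le {F : Mat} {r : ℝ} (hr : 0 ≤ r) (h : I₁ F ≤ r ^ 2) : ‖F‖ ≤ r :=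
  (Matrix.norm_le_iff hr).2 fun i j => abs_le_of_sq_le_sq ((sq_apply_le_I₁ F i j).trans h) hr

/-- With the inverse replaced by the adjugate both constraints are polynomial, hence closed; compact
sets of `Phase` can then be obtained from bounded closed sets of matrix pairs. -/
theorem isClosedEmbedding_phase_val :
    Topology.IsClosedEmbedding (Subtype.val : Phase → Mat × Mat) := by
  have h : {x : Mat × Mat | x.1.det = 1 ∧ (x.1⁻¹ * x.2).trace = 0} =
      {x | x.1.det = 1} ∩ {x | (x.1.adjugate * x.2).trace = 0} := by
    ext x
    refine and_congr_right fun hx => ?_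
    rw [inv_eq_adjugate hx]
    rfl
  have h1 : Continuous fun x : Mat × Mat => x.1.det := continuous_fst.matrix_det
  have h2 : Continuous fun x : Mat × Mat => (x.1.adjugate * x.2).trace :=
    (continuous_fst.matrix_adjugate.matrix_mul continuous_snd).matrix_trace
  have hc : IsClosed {x : Mat × Mat | x.1.det = 1 ∧ (x.1⁻¹ * x.2).trace = 0} :=
    h ▸ (isClosed_eq h1 continuous_const).inter (isClosed_eq h2 continuous_const)
  exact hc.isClosedEmbedding_subtypeVal

/-- Inside a neighbourhood of the orbit of the spherical equilibrium, sublevel sets of the energy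
slightly above its minimum are trapped. -/
theorem exists_energy_well {ρ κ : ℝ} (hρ : 0 < ρ) (hκ : 0 < κ) {V : Set Phase} (hV : IsOpen V)
    (hVorb : MulAction.orbit SymGroup (sphericalEquilibrium ρ) ⊆ V) :
    ∃ (K W : Set Phase) (m : ℝ), IsCompact K ∧ IsOpen W ∧ W ⊆ K ∧ W ⊆ V ∧
      sphericalEquilibrium ρ ∈ W ∧ hamiltonian ρ κ (sphericalEquilibrium ρ) < m ∧
      ∀ x ∈ K \ W, m ≤ hamiltonian ρ κ x := by
  have hp : sphericalEquilibrium ρ ∈ V := hVorb (MulAction.mem_orbit_self _)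
  -- A group-invariant squared norm, equal to 3 on the orbit; any bound above 3 would do in place of
  -- 4.
  let N : Mat × Mat → ℝ := fun x => I₁ x.1 + I₁ x.2
  have hN : Continuous N := (contDiff_I₁ (n := 0)).continuous.fst'.add
    (contDiff_I₁ (n := 0)).continuous.snd'
  have hN' : Continuous fun x : Phase => N x := hN.comp continuous_subtype_val
  have hNp : ∀ x : Phase, hamiltonian ρ κ x ≤ hamiltonian ρ κ (sphericalEquilibrium ρ) →
      N x < 4 := by
    intro x hx
    obtain ⟨g, rfl⟩ := mem_orbit_of_hamiltonian_le hρ hκ hx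
    change I₁ (actMat g (sphericalEquilibrium ρ : Mat × Mat).1) +
      I₁ (actMat g (sphericalEquilibrium ρ : Mat × Mat).2) < 4
    rw [I₁_actMat, I₁_actMat, sphericalEquilibrium_val]
    norm_num [I₁]
  have hK : IsCompact {x : Phase | N x ≤ 4} := by
    refine isClosedEmbedding_phase_val.isCompact_preimage (K := {x | N x ≤ 4}) ?_
    have : ProperSpace Mat := inferInstanceAs (ProperSpace (Fin 3 → Fin 3 → ℝ))
    refine Metric.isCompact_of_isClosed_isBounded (isClosed_le hN continuous_const)
      ((Metric.isBounded_closedBall (x := (0 : Mat × Mat)) (r := 2)).subset fun x hx => ?_)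
    have hx' : I₁ x.1 + I₁ x.2 ≤ 4 := hx
    rw [mem_closedBall_zero_iff]
    exact max_le (norm_le_of_I₁_le zero_le_two (by linarith [I₁_nonneg x.2]))
      (norm_le_of_I₁_le zero_le_two (by linarith [I₁_nonneg x.1]))
  have hW : IsOpen ({x : Phase | N x < 4} ∩ V) := (isOpen_lt hN' continuous_const).inter hV
  have hlt : ∀ x ∈ {x : Phase | N x ≤ 4} \ ({x : Phase | N x < 4} ∩ V),
      hamiltonian ρ κ (sphericalEquilibrium ρ) < hamiltonian ρ κ x := by
    intro x hx
    by_contra! hle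
    exact hx.2 ⟨hNp x hle, hVorb (mem_orbit_of_hamiltonian_le hρ hκ hle)⟩
  obtain ⟨m, hm, hmle⟩ : ∃ m, hamiltonian ρ κ (sphericalEquilibrium ρ) < m ∧
      ∀ x ∈ {x : Phase | N x ≤ 4} \ ({x : Phase | N x < 4} ∩ V), m ≤ hamiltonian ρ κ x := by
    -- The energy attains its minimum on the compact set `K \ W`; if that set is empty, any `m`
    -- above the equilibrium energy works.
    rcases eq_empty_or_nonempty ({x : Phase | N x ≤ 4} \ ({x : Phase | N x < 4} ∩ V)) with h | h
    · exact ⟨_, lt_add_one _, by simp [h]⟩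
    · obtain ⟨x, hx, hmin⟩ := (hK.diff hW).exists_isMinOn h
        (continuous_hamiltonian ρ κ).continuousOn
      exact ⟨_, hlt x hx, fun y hy => hmin hy⟩
  exact ⟨_, _, m, hK, hW, fun x hx => (show N x < 4 from hx.1).le, inter_subset_right,
    ⟨hNp _ le_rfl, hp⟩, hm, hmle⟩

end Dirichlet

end

theorem mainTheorem2 (ρ κ : ℝ) (hρ : 0 < ρ) (hκ : 0 < κ) :
    Dirichlet.momentumIsotropy (Dirichlet.momentum (Dirichlet.sphericalEquilibrium ρ)) = ⊤ ∧
      Dirichlet.IsMomentumStable ρ κ (Dirichlet.sphericalEquilibrium ρ) := by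
  have htop := Dirichlet.momentumIsotropy_sphericalEquilibrium ρ
  refine ⟨htop, ?_, fun U hU _ => ?_⟩
  -- For the relative equilibrium the well only supplies a global solution; containment in the orbit
  -- follows because energy stays at its minimum.
  · obtain ⟨K, W, m, hK, hW, hWK, -, hpW, hpm, hm⟩ :=
      Dirichlet.exists_energy_well (κ := κ) hρ hκ isOpen_univ (subset_univ _)
    refine ⟨(Dirichlet.evolvesIn_of_energy_lt hK hW hWK hm hpW hpm).1,
      fun c J hJ h0 hc0 hc t ht => Dirichlet.mem_orbit_of_hamiltonian_le (κ := κ) hρ hκ ?_⟩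
    choose! v hv hcv using hc
    rw [Dirichlet.hamiltonian_eq_of_hasDerivWithinAt hJ (fun t ht => ⟨v t, 1, hv t ht, by
      simpa using hcv t ht⟩) h0 ht, hc0]
  · obtain ⟨V, hV, horb, hVU⟩ := mem_nhdsSet_iff_exists.1 hU
    have horb' : MulAction.orbit Dirichlet.SymGroup (Dirichlet.sphericalEquilibrium ρ) ⊆ V := by
      rintro _ ⟨g, rfl⟩
      exact horb ⟨⟨g, htop ▸ Subgroup.mem_top g⟩, rfl⟩
    obtain ⟨K, W, m, hK, hW, hWK, hWV, hpW, hpm, hm⟩ :=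
      Dirichlet.exists_energy_well (κ := κ) hρ hκ hV horb'
    -- Initial points must lie inside the well and below its rim; both conditions are open and hold
    -- at the equilibrium.
    refine ⟨W ∩ {x | Dirichlet.hamiltonian ρ κ x < m}, (hW.inter (isOpen_lt
      (Dirichlet.continuous_hamiltonian ρ κ) continuous_const)).mem_nhds ⟨hpW, hpm⟩,
      fun q hq => ?_⟩
    have := Dirichlet.evolvesIn_of_energy_lt hK hW hWK hm hq.1 hq.2
    exact ⟨this.1, fun c J hJ h0 hc0 hc t ht => hVU (hWV (this.2 c J hJ h0 hc0 hc t ht))⟩
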